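/- **Network.** Let $\Gamma=\bigcup_{\gamma\in\mathbf E}\gamma([0,|\gamma|])\subset\mathbb R^d$ be a connected network: $\mathbf E$ is a finite set of simple $C^1$ curves (arcs), injective on $[0,|\gamma|]$ (so there are no self-loops), parametrized by arc length, closed under reversal $\gamma\mapsto\widetilde\gamma=\gamma(|\gamma|-\cdot)$; arcs that are not equal or reversed to each other meet only at endpoints (the vertices, forming the set $\mathbf V$); any two vertices are linked by a finite chain of arcs. Let $\mathbf E^+\subset\mathbf E$ contain exactly one arc of each pair $\{\gamma,\widetilde\gamma\}$, and for $x\in\mathbf V$ let $\mathbf E^+_x$ be the set of $\gamma\in\mathbf E^+$ incident on $x$. **Hamiltonians.** Let $\widetilde H_\gamma:[0,|\gamma|]\times\mathbb R\to\mathbb R$ ($\gamma\in\mathbf E$) be continuous, convex in $\mu$, superlinear in $\mu$ uniformly in $s$, Lipschitz in $s$ for each $\mu$, with $\widetilde H_{\widetilde\gamma}(s,\mu)=\widetilde H_\gamma(|\gamma|-s,-\mu)$. Let $c:\mathbf V\to\mathbb R$ be a flux limiter: $c_x\le -\max_s\min_\mu\widetilde H_\gamma(s,\mu)$ for all $x\in\mathbf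 V$, $\gamma\in\mathbf E^+_x$. Let $g:\Gamma\to\mathbb R$ be Lipschitz and $T>0$. **Modified Hamiltonians.** Fix a compact interval $I\subset\mathbb R$, a constant $\beta_0$ and constants $\mu_\gamma>0$ such that for every $\gamma$: $\beta_0$ is larger than some Lipschitz constant, uniform in $s$, of $\mu\mapsto\widetilde H_\gamma(s,\mu)$ on some compact neighbourhood of $I$, and for every $s\in[0,|\gamma|]$ $$\widetilde H_\gamma(s,\mu)>\widetilde H_\gamma(s,-\mu_\gamma)-\beta_0(\mu+\mu_\gamma)\ (\mu<-\mu_\gamma),\qquad \widetilde H_\gamma(s,\mu)>\widetilde H_\gamma(s,\mu_\gamma)+\beta_0(\mu-\mu_\gamma)\ (\mu>\mu_\gamma).$$ Let $H_\gamma(s,\cdot)$ be the convex envelope of the function equal to $\widetilde H_\gamma(s,\mu)$ for $|\mu|\le\mu_\gamma$, to $\widetilde H_\gamma(s,-\mu_\gamma)-\beta_0(\mu+\mu_\gamma)$ for $\mu<-\mu_\gamma$ and to $\widetilde H_\gamma(s,\mu_\gamma)+\beta_0(\mu-\mu_\gamma)$ for $\mu>\mu_\gamma$. Let $L_\gamma(s,\lambda)=\sup_{\mu}\,(\mu\lambda-H_\gamma(s,\mu))\in(-\infty,+\infty]$.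 **Scheme.** A pair $(\Delta x,\Delta t)$ is admissible if $0<\Delta x<|\gamma|$ for all $\gamma\in\mathbf E^+$, $0<\Delta t<T$ and $\Delta x\le\Delta t$. Put $N_\gamma=\lceil|\gamma|/\Delta x\rceil$, $N_T=\lceil T/\Delta t\rceil$, $s^\gamma_i=i|\gamma|/N_\gamma$ ($0\le i\le N_\gamma$), $t_n=nT/N_T$ ($0\le n\le N_T$), $h=T/N_T$; the grid is the set of the points $(\gamma(s^\gamma_i),t_n)$, $\gamma\in\mathbf E^+$. For $w$ defined at the spatial grid points let $I_\gamma[w]$ be the piecewise linear interpolation of $w\circ\gamma$ on $[0,|\gamma|]$ with nodes $s_i^\gamma$, and $$S_\gamma[w](s)=\min_{\frac{s-|\gamma|}{h}\le\alpha\le\frac sh}\big\{I_\gamma[w](s-h\alpha)+h\,L_\gamma(s,\alpha)\big\}.$$ The scheme solution $v$ on the grid is given by $v(\cdot,0)=g$, and for $0\le n<N_T$ by $$v(\gamma(s_i^\gamma),t_{n+1})=S_\gamma[v(\cdot,t_n)](s_i^\gamma)\quad(\gamma\in\mathbf E^+,\ 0<i<N_\gamma),$$ $$v(x,t_{n+1})=\min\Big\{\min_{\gamma\in\mathbf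 E^+_x}S_\gamma[v(\cdot,t_n)](\gamma^{-1}(x)),\ v(x,t_n)+c_x h\Big\}\quad(x\in\mathbf V).$$ **Theorem.** Let $(\Delta_m x,\Delta_m t)$ be admissible pairs with $\Delta_m x\to0$, $\Delta_m t\to0$ and $\Delta_m x/\Delta_m t\to0$, and let $v_m$ be the corresponding scheme solutions. Let $u:\Gamma\times[0,T]\to\mathbb R$ be a uniform limit of a subsequence $(v_{m_k})_k$, in the sense that $v_{m_k}(y_k)\to u(y)$ whenever $y_k$ belongs to the grid of index $m_k$ for every $k$ and $y_k\to y\in\Gamma\times[0,T]$. Then for every $x\in\mathbf V$ and every $t_0\in(0,T]$ the following holds. If there is a function $\psi$ of class $C^1$ near $t_0$ such that $u(x,\cdot)-\psi$ has at $t_0$ a local minimum relative to $[0,T]$ and $\psi'(t_0)<c_x$, then there is an arc $\gamma\in\mathbf E^+_x$ such that every function $\varphi$, of class $C^1$ near $(\gamma^{-1}(x),t_0)$, for which $(s,t)\mapsto u(\gamma(s),t)-\varphi(s,t)$ has at $(\gamma^{-1}(x),t_0)$ a local minimum relative to $[0,|\gamma|]\times[0,T]$ satisfies $$\varphi_t(\gamma^{-1}(x),t_0)+H_\gamma\big(\gamma^{-1}(x),\varphi'(\gamma^{-1}(x),t_0)\big)\ge0,$$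 where $\varphi'$ denotes the derivative of $\varphi$ in $s$. -/

import Mathlib

open Set Filter Topology
open scoped NNReal

/-- A network in `ℝ^d`. `E` indexes the arcs; each arc `e` is a simple `C¹` curve
parametrized by arc length on `[0, len e]` (only the values there matter). The set of arcs is
closed under reversal, distinct arcs that are not the reversal of each other meet at most at
their endpoints, any two vertices are linked by a chain of arcs, and `pos` is an orientation.
Injectivity on the closed interval excludes self-loops. -/
structure Network (d : ℕ) (E : Type*) where
  len : E → ℝ
  len_pos : ∀ e, 0 < len e
  curve : E → ℝ → EuclideanSpace ℝ (Fin d)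
  contDiffOn : ∀ e, ContDiffOn ℝ 1 (curve e) (Icc 0 (len e))
  unit_speed : ∀ e, ∀ s ∈ Icc 0 (len e), ‖derivWithin (curve e) (Icc 0 (len e)) s‖ = 1
  injOn : ∀ e, InjOn (curve e) (Icc 0 (len e))
  rev : E → E
  rev_rev : ∀ e, rev (rev e) = e
  len_rev : ∀ e, len (rev e) = len e
  curve_rev : ∀ e, ∀ s ∈ Icc 0 (len e), curve (rev e) s = curve e (len e - s)
  inter_endpoints : ∀ e e', e' ≠ e → e' ≠ rev e →
    ∀ s ∈ Icc 0 (len e), ∀ s' ∈ Icc 0 (len e'), curve e s = curve e' s' →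
      (s = 0 ∨ s = len e) ∧ (s' = 0 ∨ s' = len e')
  connected : ∀ e e', Relation.ReflTransGen (fun x y => ∃ a, curve a 0 = x ∧ curve a (len a) = y)
    (curve e 0) (curve e' 0)
  pos : Set E
  pos_iff : ∀ e, e ∈ pos ↔ rev e ∉ pos

/-! ### Hamiltonians -/

/-- Continuity, convexity, uniform superlinearity and Lipschitz continuity in `s` of a Hamiltonian
on `[0, ℓ] × ℝ`. -/
structure IsArcHamiltonian (ℓ : ℝ) (H : ℝ → ℝ → ℝ) : Prop where
  continuousOn : ContinuousOn (fun p : ℝ × ℝ => H p.1 p.2) (Icc 0 ℓ ×ˢ univ)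
  convex : ∀ s ∈ Icc 0 ℓ, ConvexOn ℝ univ (H s)
  superlinear : ∀ K : ℝ, ∃ R : ℝ, ∀ s ∈ Icc 0 ℓ, ∀ μ : ℝ, R ≤ |μ| → K * |μ| ≤ H s μ
  lipschitz : ∀ μ : ℝ, ∃ K : ℝ≥0, LipschitzOnWith K (fun s => H s μ) (Icc 0 ℓ)

/-- Admissible parameters for the modification of `H` relative to the momentum set `I`:
`β₀` exceeds a Lipschitz constant of `H` in the momentum variable on a compact neighbourhood
of `I`, and beyond `±μ₀` the graph of `H s` lies above the lines of slope `±β₀`. -/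
structure IsModificationParam (ℓ : ℝ) (H : ℝ → ℝ → ℝ) (I : Set ℝ) (β₀ μ₀ : ℝ) : Prop where
  lip : ∃ (J : Set ℝ) (β : ℝ≥0), IsCompact J ∧ J ∈ 𝓝ˢ I ∧
    (∀ s ∈ Icc 0 ℓ, LipschitzOnWith β (H s) J) ∧ (β : ℝ) < β₀
  pos : 0 < μ₀
  left : ∀ s ∈ Icc 0 ℓ, ∀ μ, μ < -μ₀ → H s (-μ₀) - β₀ * (μ + μ₀) < H s μ
  right : ∀ s ∈ Icc 0 ℓ, ∀ μ, μ₀ < μ → H s μ₀ + β₀ * (μ - μ₀) < H s μ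

/-- `H` on `[-μ₀, μ₀]`, continued with slopes `±β₀` outside. -/
noncomputable def truncHam (H : ℝ → ℝ → ℝ) (β₀ μ₀ : ℝ) (s μ : ℝ) : ℝ :=
  if μ < -μ₀ then H s (-μ₀) - β₀ * (μ + μ₀)
  else if μ₀ < μ then H s μ₀ + β₀ * (μ - μ₀)
  else H s μ

/-- The convex envelope: the largest convex function not exceeding `f`. -/
noncomputable def convexEnvelope (f : ℝ → ℝ) (μ : ℝ) : ℝ :=
  sSup {y | ∃ h : ℝ → ℝ, ConvexOn ℝ univ h ∧ (∀ ν, h ν ≤ f ν) ∧ y = h μ}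

/-- The modified Hamiltonian. -/
noncomputable def modHam (H : ℝ → ℝ → ℝ) (β₀ μ₀ : ℝ) (s : ℝ) : ℝ → ℝ :=
  convexEnvelope (truncHam H β₀ μ₀ s)

/-- The Lagrangian, i.e. the convex conjugate of `H s`, with values in the extended reals. -/
noncomputable def lagrangian (H : ℝ → ℝ → ℝ) (s lam : ℝ) : EReal :=
  ⨆ μ : ℝ, ((μ * lam - H s μ : ℝ) : EReal)

/-! ### Uniform convergence of functions defined on varying subsets -/

/-- `v m : Y m → ℝ` converges uniformly to `u : Y' → ℝ`: `v m (y m) → u y` whenever `y m ∈ Y m`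
and `y m → y ∈ Y'`. -/
def ConvergesUniformlyOnGrids {M : Type*} [TopologicalSpace M] (Y : ℕ → Set M) (Y' : Set M)
    (v : ℕ → M → ℝ) (u : M → ℝ) : Prop :=
  ∀ y ∈ Y', ∀ z : ℕ → M, (∀ m, z m ∈ Y m) → Tendsto z atTop (𝓝 y) →
    Tendsto (fun m => v m (z m)) atTop (𝓝 (u y))

/-! ### Time grid -/

/-- Number of subintervals of the time grid. -/
noncomputable def timeSteps (T dt : ℝ) : ℕ := ⌈T / dt⌉₊

/-- Spacing of the (uniform) time grid of `[0, T]`. -/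
noncomputable def timeMesh (T dt : ℝ) : ℝ := T / timeSteps T dt

/-- Nodes of the time grid. -/
noncomputable def timeNode (T dt : ℝ) (n : ℕ) : ℝ := n * T / timeSteps T dt

namespace Network

variable {d : ℕ} {E : Type*} (G : Network d E)

/-- The support of an arc. -/
def support (e : E) : Set (EuclideanSpace ℝ (Fin d)) := G.curve e '' Icc 0 (G.len e)

/-- The network as a subset of `ℝ^d`. -/
def carrier : Set (EuclideanSpace ℝ (Fin d)) := ⋃ e, G.support e

/-- The set of vertices. -/
def vertices : Set (EuclideanSpace ℝ (Fin d)) :=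
  {x | ∃ e, x = G.curve e 0 ∨ x = G.curve e (G.len e)}

/-- The arcs of the orientation passing through `x`; for a vertex `x` these are the arcs of the
orientation incident on `x`, because a vertex is never in the relative interior of an arc. -/
def posAt (x : EuclideanSpace ℝ (Fin d)) : Set E := {e | e ∈ G.pos ∧ x ∈ G.support e}

/-- The inverse of the parametrization of an arc. -/
noncomputable def param (e : E) (x : EuclideanSpace ℝ (Fin d)) : ℝ :=
  Function.invFunOn (G.curve e) (Icc 0 (G.len e)) x

/-- A Hamiltonian on the network. -/
structure IsHamiltonian (H : E → ℝ → ℝ → ℝ) : Prop where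
  arc : ∀ e, IsArcHamiltonian (G.len e) (H e)
  compat : ∀ e, ∀ s ∈ Icc 0 (G.len e), ∀ μ, H (G.rev e) s μ = H e (G.len e - s) (-μ)

/-- The constant `- max_s min_μ H e s μ`. -/
noncomputable def fluxBound (H : E → ℝ → ℝ → ℝ) (e : E) : ℝ :=
  - sSup ((fun s => ⨅ μ : ℝ, H e s μ) '' Icc 0 (G.len e))

/-- `c` is a flux limiter for `H`. -/
def IsFluxLimiter (H : E → ℝ → ℝ → ℝ) (c : EuclideanSpace ℝ (Fin d) → ℝ) : Prop :=
  ∀ x ∈ G.vertices, ∀ e ∈ G.posAt x, c x ≤ G.fluxBound H e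

/-! ### Discretization and scheme -/

/-- Admissible pair of space and time steps. -/
structure IsAdmissible (T dx dt : ℝ) : Prop where
  dx_pos : 0 < dx
  dx_lt : ∀ e ∈ G.pos, dx < G.len e
  dt_pos : 0 < dt
  dt_lt : dt < T
  dx_le_dt : dx ≤ dt

/-- Number of subintervals of the space grid of an arc. -/
noncomputable def arcSteps (dx : ℝ) (e : E) : ℕ := ⌈G.len e / dx⌉₊

/-- Nodes of the (uniform) space grid of an arc. -/
noncomputable def arcNode (dx : ℝ) (e : E) (i : ℕ) : ℝ := i * G.len e / G.arcSteps dx e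

/-- The space-time grid on the network. -/
def grid (T dx dt : ℝ) : Set (EuclideanSpace ℝ (Fin d) × ℝ) :=
  {p | ∃ e ∈ G.pos, ∃ i ≤ G.arcSteps dx e, ∃ n ≤ timeSteps T dt,
    p = (G.curve e (G.arcNode dx e i), timeNode T dt n)}

/-- Index of a cell `[s_i, s_{i+1}]` of the space grid containing `s ∈ [0, len e]`. -/
noncomputable def cellIndex (dx : ℝ) (e : E) (s : ℝ) : ℕ :=
  min ⌊s * G.arcSteps dx e / G.len e⌋₊ (G.arcSteps dx e - 1)

/-- Piecewise linear interpolation along the arc `e` of `w ∘ curve e`, for `w` defined on grid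
points. -/
noncomputable def interp (dx : ℝ) (e : E) (w : EuclideanSpace ℝ (Fin d) → ℝ) (s : ℝ) : ℝ :=
  let i := G.cellIndex dx e s
  let a := G.arcNode dx e i
  let b := G.arcNode dx e (i + 1)
  w (G.curve e a) + (s - a) / (b - a) * (w (G.curve e b) - w (G.curve e a))

/-- The semi-Lagrangian operator on the arc `e` at `s`, with time step `h`: the minimum over
`(s - len e) / h ≤ α ≤ s / h` of `interp w (s - h α) + h L_e(s, α)`. -/
noncomputable def arcOp (H : E → ℝ → ℝ → ℝ) (dx h : ℝ) (e : E)
    (w : EuclideanSpace ℝ (Fin d) → ℝ) (s : ℝ) : EReal :=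
  ⨅ α ∈ Icc ((s - G.len e) / h) (s / h),
    ((G.interp dx e w (s - h * α) : ℝ) : EReal) + (h : EReal) * lagrangian (H e) s α

/-- `v` solves the evolutive discrete problem with Hamiltonians `H`, flux limiter `c`, initial datum
`g` and steps `dx`, `dt`. Only the values of `v` on the grid are involved. -/
structure IsSchemeSolution (H : E → ℝ → ℝ → ℝ) (c g : EuclideanSpace ℝ (Fin d) → ℝ)
    (T dx dt : ℝ) (v : EuclideanSpace ℝ (Fin d) × ℝ → ℝ) : Prop where
  initial : ∀ e ∈ G.pos, ∀ i ≤ G.arcSteps dx e,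
    v (G.curve e (G.arcNode dx e i), 0) = g (G.curve e (G.arcNode dx e i))
  interior : ∀ n < timeSteps T dt, ∀ e ∈ G.pos, ∀ i, 0 < i → i < G.arcSteps dx e →
    ((v (G.curve e (G.arcNode dx e i), timeNode T dt (n + 1)) : ℝ) : EReal) =
      G.arcOp H dx (timeMesh T dt) e (fun y => v (y, timeNode T dt n)) (G.arcNode dx e i)
  vertex : ∀ n < timeSteps T dt, ∀ x ∈ G.vertices,
    ((v (x, timeNode T dt (n + 1)) : ℝ) : EReal) =
      min (⨅ e ∈ G.posAt x,
          G.arcOp H dx (timeMesh T dt) e (fun y => v (y, timeNode T dt n)) (G.param e x))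
        ((v (x, timeNode T dt n) + c x * timeMesh T dt : ℝ) : EReal)

/-! ### Supersolution condition at a vertex -/

/-- `ψ` is a `C¹` subtangent to `f : [0, T] → ℝ` at `t₀`. -/
def IsSubtangent (T : ℝ) (f ψ : ℝ → ℝ) (t₀ : ℝ) : Prop :=
  ContDiffAt ℝ 1 ψ t₀ ∧ IsLocalMinOn (fun t => f t - ψ t) (Icc 0 T) t₀

/-- `φ` is a `C¹` subtangent to `f` at `p`, constrained to `[0, ℓ] × [0, T]`. -/
def IsConstrainedSubtangent (ℓ T : ℝ) (f φ : ℝ × ℝ → ℝ) (p : ℝ × ℝ) : Prop :=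
  ContDiffAt ℝ 1 φ p ∧ IsLocalMinOn (fun q => f q - φ q) (Icc 0 ℓ ×ˢ Icc 0 T) p

/-- The supersolution condition at the vertex `x` for the Hamiltonians `H` and the flux limiter
`c`, at all times `t₀ ∈ (0, T]`. -/
def SupersolutionAtVertex (H : E → ℝ → ℝ → ℝ) (c : EuclideanSpace ℝ (Fin d) → ℝ) (T : ℝ)
    (u : EuclideanSpace ℝ (Fin d) × ℝ → ℝ) (x : EuclideanSpace ℝ (Fin d)) : Prop :=
  ∀ t₀ ∈ Ioc 0 T,
    (∃ ψ : ℝ → ℝ, IsSubtangent T (fun t => u (x, t)) ψ t₀ ∧ deriv ψ t₀ < c x) →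
    ∃ e ∈ G.posAt x, ∀ φ : ℝ × ℝ → ℝ,
      IsConstrainedSubtangent (G.len e) T (fun q => u (G.curve e q.1, q.2)) φ
        (G.param e x, t₀) →
      0 ≤ deriv (fun t => φ (G.param e x, t)) t₀ +
        H e (G.param e x) (deriv (fun s => φ (s, t₀)) (G.param e x))

end Network

/-! ### Convex envelopes and modified Hamiltonians -/

/-! Suppose that on every arc incident on `x` some subtangent violates the inequality. Linearizing
gives, for times up to `t₀`, a lower bound of `u` on each arc `e` with time slope `P e`, space slope
`Q e`, the strict inequality `P e + H e s (Q e) ≤ -ρ`, and a surplus `ρ * |s - s₀|` away from the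
vertex. The function `ψ` gives a bound at the vertex with slope `P₀ < c x`. Looking backwards from
`t₀`, a smaller slope is a better bound; so at the vertex the minimum `p` of `P₀` and the `P e` is
available, and it satisfies both `p < c x` and `p ≤ P e`.

The scheme improves these bounds. Time slopes may be raised by `ρ`, to `p + ρ ≤ c x` at the vertex
and to `P e + ρ` on the arcs, and remain compatible with one step of the scheme. A barrier with the
raised slopes lies below the known bounds at earlier times and away from the vertex, where the
surplus pays for it, yet exceeds `u (x, t₀)` by `κ` at `(x, t₀)`. Induction on time steps keeps the
scheme solution above it (`IsSchemeSolution.le_vertex`), and the limit gives `u (x, t₀) + κ ≤ u (x,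
t₀)`.

The comparison is local because the modified Hamiltonians have slopes at most `β₀`: velocities above
`β₀` cost infinitely much (`lagrangian_modHam_eq_top`). One step is controlled by Fenchel's
inequality at the single momentum `Q e` (`le_arcOp`). Bounds pass from `u` to the grid functions by
compactness (`eventually_lower_bound`). -/

lemma bddAbove_convexMinorants (f : ℝ → ℝ) (μ : ℝ) :
    BddAbove {y | ∃ h : ℝ → ℝ, ConvexOn ℝ univ h ∧ (∀ ν, h ν ≤ f ν) ∧ y = h μ} :=
  ⟨f μ, by rintro y ⟨h, -, hf, rfl⟩; exact hf μ⟩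

/-- A lower bound of `f` is indispensable: without a convex minorant the real `sSup` would be the
junk value `0`. -/
lemma nonempty_convexMinorants {f : ℝ → ℝ} {m : ℝ} (hm : ∀ ν, m ≤ f ν) (μ : ℝ) :
    {y | ∃ h : ℝ → ℝ, ConvexOn ℝ univ h ∧ (∀ ν, h ν ≤ f ν) ∧ y = h μ}.Nonempty :=
  ⟨m, fun _ => m, convexOn_const _ convex_univ, hm, rfl⟩

lemma convexEnvelope_le {f : ℝ → ℝ} {m : ℝ} (hm : ∀ ν, m ≤ f ν) (μ : ℝ) :
    convexEnvelope f μ ≤ f μ :=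
  csSup_le (nonempty_convexMinorants hm μ) (by rintro y ⟨h, -, hf, rfl⟩; exact hf μ)

lemma le_convexEnvelope {f h : ℝ → ℝ} (hc : ConvexOn ℝ univ h) (hf : ∀ ν, h ν ≤ f ν) (μ : ℝ) :
    h μ ≤ convexEnvelope f μ :=
  le_csSup (bddAbove_convexMinorants f μ) ⟨h, hc, hf, rfl⟩

lemma convexOn_convexEnvelope {f : ℝ → ℝ} {m : ℝ} (hm : ∀ ν, m ≤ f ν) :
    ConvexOn ℝ univ (convexEnvelope f) := by
  refine ⟨convex_univ, fun x _ y _ a b ha hb hab => ?_⟩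
  refine csSup_le (nonempty_convexMinorants hm _) ?_
  rintro z ⟨h, hc, hf, rfl⟩
  refine (hc.2 (mem_univ x) (mem_univ y) ha hb hab).trans ?_
  simp only [smul_eq_mul]
  have h1 := le_convexEnvelope hc hf x
  have h2 := le_convexEnvelope hc hf y
  gcongr

lemma convexEnvelope_le_add {f g : ℝ → ℝ} {m ω : ℝ} (hm : ∀ ν, m ≤ f ν)
    (hfg : ∀ ν, f ν ≤ g ν + ω) (μ : ℝ) : convexEnvelope f μ ≤ convexEnvelope g μ + ω := by
  refine csSup_le (nonempty_convexMinorants hm _) ?_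
  rintro z ⟨h, hc, hf, rfl⟩
  have := le_convexEnvelope (f := g) (h := fun ν => h ν + -ω) (hc.add_const (-ω))
    (fun ν => by linarith [hf ν, hfg ν]) μ
  linarith

lemma continuous_convexEnvelope {f : ℝ → ℝ} {m : ℝ} (hm : ∀ ν, m ≤ f ν) :
    Continuous (convexEnvelope f) :=
  continuousOn_univ.1 ((convexOn_convexEnvelope hm).continuousOn isOpen_univ)

/-! ### Stability and finite speed of the modified Hamiltonian -/

section Modification

variable {ℓ β₀ μ₀ : ℝ} {H : ℝ → ℝ → ℝ}

lemma exists_le_truncHam (hH : IsArcHamiltonian ℓ H) (hβ : 0 ≤ β₀) (hμ : 0 < μ₀)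
    {s : ℝ} (hs : s ∈ Icc 0 ℓ) : ∃ m, ∀ ν, m ≤ truncHam H β₀ μ₀ s ν := by
  have hcont : ContinuousOn (H s) (Icc (-μ₀) μ₀) :=
    hH.continuousOn.comp (f := fun ν => (s, ν)) (by fun_prop) (fun ν _ => ⟨hs, mem_univ _⟩)
  obtain ⟨m, hm⟩ := (isCompact_Icc.image_of_continuousOn hcont).bddBelow
  have hm' : ∀ ν ∈ Icc (-μ₀) μ₀, m ≤ H s ν := fun ν hν => hm (mem_image_of_mem _ hν)
  refine ⟨m, fun ν => ?_⟩
  unfold truncHam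
  split_ifs with h1 h2
  · have := hm' (-μ₀) ⟨le_rfl, by linarith⟩
    nlinarith
  · have := hm' μ₀ ⟨by linarith, le_rfl⟩
    nlinarith
  · exact hm' ν ⟨by linarith, by linarith⟩

/-- The outer slopes do not depend on `s`, so a comparison on the compact momentum interval extends
to all momenta. -/
lemma truncHam_le_add {s s₀ ω : ℝ} (hμ : 0 < μ₀)
    (h : ∀ ν ∈ Icc (-μ₀) μ₀, H s ν ≤ H s₀ ν + ω) (ν : ℝ) :
    truncHam H β₀ μ₀ s ν ≤ truncHam H β₀ μ₀ s₀ ν + ω := by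
  unfold truncHam
  split_ifs with h1 h2
  · linarith [h (-μ₀) ⟨le_rfl, by linarith⟩]
  · linarith [h μ₀ ⟨by linarith, le_rfl⟩]
  · exact h ν ⟨by linarith, by linarith⟩

lemma IsArcHamiltonian.exists_forall_le_add (hH : IsArcHamiltonian ℓ H) {s₀ : ℝ}
    (hs₀ : s₀ ∈ Icc 0 ℓ) (M : ℝ) {ω : ℝ} (hω : 0 < ω) :
    ∃ ρ > 0, ∀ s ∈ Icc 0 ℓ, |s - s₀| < ρ → ∀ ν ∈ Icc (-M) M, H s ν ≤ H s₀ ν + ω := by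
  have hc : IsCompact (Icc 0 ℓ ×ˢ Icc (-M) M) := isCompact_Icc.prod isCompact_Icc
  have hu := hc.uniformContinuousOn_of_continuous
    (hH.continuousOn.mono (prod_mono le_rfl (subset_univ _)))
  rw [Metric.uniformContinuousOn_iff] at hu
  obtain ⟨ρ, hρ, h⟩ := hu ω hω
  refine ⟨ρ, hρ, fun s hs hd ν hν => ?_⟩
  have := h (s, ν) ⟨hs, hν⟩ (s₀, ν) ⟨hs₀, hν⟩ (by simpa [Prod.dist_eq, Real.dist_eq, hρ] using hd)
  rw [Real.dist_eq] at this
  linarith [(abs_lt.1 this).2]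

lemma modHam_le_truncHam (hH : IsArcHamiltonian ℓ H) (hβ : 0 ≤ β₀) (hμ : 0 < μ₀)
    {s : ℝ} (hs : s ∈ Icc 0 ℓ) (ν : ℝ) : modHam H β₀ μ₀ s ν ≤ truncHam H β₀ μ₀ s ν := by
  obtain ⟨m, hm⟩ := exists_le_truncHam hH hβ hμ hs
  exact convexEnvelope_le hm ν

/-- Strict negativity of `p + modHam s₀ q` is stable under perturbations of all the arguments. -/
lemma exists_add_modHam_le_neg (hH : IsArcHamiltonian ℓ H) (hβ : 0 ≤ β₀) (hμ : 0 < μ₀)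
    {s₀ p q : ℝ} (hs₀ : s₀ ∈ Icc 0 ℓ) (hneg : p + modHam H β₀ μ₀ s₀ q < 0) :
    ∃ ρ > 0, ∀ s ∈ Icc 0 ℓ, ∀ P Q, |s - s₀| ≤ ρ → |P - p| ≤ ρ → |Q - q| ≤ ρ →
      P + modHam H β₀ μ₀ s Q ≤ -ρ := by
  set A := -(p + modHam H β₀ μ₀ s₀ q) with hA
  have hApos : 0 < A := by linarith
  obtain ⟨m₀, hm₀⟩ := exists_le_truncHam hH hβ hμ hs₀
  have hcont : Continuous (modHam H β₀ μ₀ s₀) := continuous_convexEnvelope hm₀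
  obtain ⟨ρ₁, hρ₁, h₁⟩ := hH.exists_forall_le_add hs₀ μ₀ (ω := A / 4) (by linarith)
  obtain ⟨ρ₂, hρ₂, h₂⟩ := Metric.continuous_iff.1 hcont q (A / 4) (by linarith)
  -- Three errors of at most `A / 4`, from `P`, `s` and `Q`, leave `-A / 4`. The halves turn the
  -- non-strict bounds into the strict ones required by `h₁` and `h₂`.
  refine ⟨min (min (ρ₁ / 2) (ρ₂ / 2)) (A / 4), by positivity, fun s hs P Q hsd hP hQ => ?_⟩
  have e1 : min (min (ρ₁ / 2) (ρ₂ / 2)) (A / 4) ≤ ρ₁ / 2 :=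
    (min_le_left _ _).trans (min_le_left _ _)
  have e2 : min (min (ρ₁ / 2) (ρ₂ / 2)) (A / 4) ≤ ρ₂ / 2 :=
    (min_le_left _ _).trans (min_le_right _ _)
  have e3 : min (min (ρ₁ / 2) (ρ₂ / 2)) (A / 4) ≤ A / 4 := min_le_right _ _
  obtain ⟨m, hm⟩ := exists_le_truncHam hH hβ hμ hs
  have k1 : modHam H β₀ μ₀ s Q ≤ modHam H β₀ μ₀ s₀ Q + A / 4 :=
    convexEnvelope_le_add hm (truncHam_le_add hμ (h₁ s hs (by linarith))) Q
  have k2 := h₂ Q (by rw [Real.dist_eq]; linarith)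
  rw [Real.dist_eq] at k2
  linarith [(abs_lt.1 k2).2, (abs_le.1 hP).2]

lemma le_lagrangian (H : ℝ → ℝ → ℝ) (s lam μ : ℝ) :
    ((μ * lam - H s μ : ℝ) : EReal) ≤ lagrangian H s lam :=
  le_iSup (fun μ : ℝ => ((μ * lam - H s μ : ℝ) : EReal)) μ

/-- Since `modHam` grows at most with slope `β₀`, momenta of the same sign as `α` make `μ * α -
modHam H β₀ μ₀ s μ` grow with slope at least `|α| - β₀ > 0`. This is the finite speed of
propagation. -/
lemma lagrangian_modHam_eq_top (hH : IsArcHamiltonian ℓ H) (hβ : 0 ≤ β₀) (hμ : 0 < μ₀)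
    {s : ℝ} (hs : s ∈ Icc 0 ℓ) {α : ℝ} (hα : β₀ < |α|) :
    lagrangian (modHam H β₀ μ₀) s α = ⊤ := by
  rw [EReal.eq_top_iff_forall_lt]
  intro y
  obtain ⟨C, hC⟩ : ∃ C, ∀ μ, μ₀ < |μ| → 0 ≤ μ * α → μ * α - modHam H β₀ μ₀ s μ ≥
      |μ| * (|α| - β₀) - C := by
    refine ⟨max (H s μ₀) (H s (-μ₀)), fun μ hμ' hs' => ?_⟩
    have hle := modHam_le_truncHam hH hβ hμ hs μ
    have e : μ * α = |μ| * |α| := by rw [← abs_mul, abs_of_nonneg hs']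
    have m1 := le_max_left (H s μ₀) (H s (-μ₀))
    have m2 := le_max_right (H s μ₀) (H s (-μ₀))
    have m3 : 0 ≤ β₀ * μ₀ := by positivity
    unfold truncHam at hle
    rw [e]
    split_ifs at hle with h1 h2
    · rw [abs_of_neg (by linarith : μ < 0)]
      nlinarith
    · rw [abs_of_pos (by linarith : 0 < μ)]
      nlinarith
    · exact absurd (abs_le.2 ⟨not_lt.1 h1, not_lt.1 h2⟩) (not_le.2 hμ')
  have hd : 0 < |α| - β₀ := by linarith
  have hα0 : α ≠ 0 := by
    rintro rfl
    simp at hα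
    linarith
  set t := max (μ₀ + 1) ((y + C + 1) / (|α| - β₀)) with ht
  have ht0 : 0 < t := lt_of_lt_of_le (by linarith) (le_max_left _ _)
  have ht1 : μ₀ < t := lt_of_lt_of_le (by linarith) (le_max_left _ _)
  have ht2 : y + C + 1 ≤ t * (|α| - β₀) := (div_le_iff₀ hd).1 (le_max_right _ _)
  obtain ⟨μ, hμt, hμα⟩ : ∃ μ, |μ| = t ∧ 0 ≤ μ * α := by
    rcases le_total 0 α with h | h
    · exact ⟨t, abs_of_pos ht0, by positivity⟩
    · exact ⟨-t, by rw [abs_neg, abs_of_pos ht0], by nlinarith⟩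
  refine lt_of_lt_of_le ?_ (le_lagrangian _ s α μ)
  have := hC μ (by rw [hμt]; exact ht1) hμα
  rw [hμt] at this
  exact_mod_cast (by linarith : y < μ * α - modHam H β₀ μ₀ s μ)

end Modification

/-! ### Grids -/

lemma timeSteps_pos {T dt : ℝ} (hT : 0 < T) (hdt : 0 < dt) : 0 < timeSteps T dt :=
  Nat.ceil_pos.2 (div_pos hT hdt)

lemma timeMesh_pos {T dt : ℝ} (hT : 0 < T) (hdt : 0 < dt) : 0 < timeMesh T dt :=
  div_pos hT (Nat.cast_pos.2 (timeSteps_pos hT hdt))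

lemma timeMesh_le {T dt : ℝ} (hT : 0 < T) (hdt : 0 < dt) : timeMesh T dt ≤ dt := by
  have h := Nat.le_ceil (T / dt)
  rw [div_le_iff₀ hdt] at h
  rw [timeMesh, div_le_iff₀ (Nat.cast_pos.2 (timeSteps_pos hT hdt)), mul_comm]
  exact h

lemma timeNode_eq (T dt : ℝ) (n : ℕ) : timeNode T dt n = n * timeMesh T dt :=
  mul_div_assoc _ _ _

lemma timeNode_succ (T dt : ℝ) (n : ℕ) :
    timeNode T dt (n + 1) = timeNode T dt n + timeMesh T dt := by
  simp only [timeNode_eq]; push_cast; ring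

/-- Every time has a grid node just before it. -/
lemma exists_timeNode_near {T dt : ℝ} (hT : 0 < T) (hdt : 0 < dt) {t : ℝ} (ht : t ∈ Icc 0 T) :
    ∃ n ≤ timeSteps T dt, timeNode T dt n ≤ t ∧ t - dt ≤ timeNode T dt n := by
  have hh := timeMesh_pos hT hdt
  refine ⟨⌊t / timeMesh T dt⌋₊, ?_, ?_, ?_⟩
  · refine Nat.floor_le_of_le ?_
    rw [div_le_iff₀ hh, timeMesh, mul_div_cancel₀]
    · exact ht.2
    · exact (Nat.cast_pos.2 (timeSteps_pos hT hdt)).ne'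
  · rw [timeNode_eq, ← le_div_iff₀ hh]
    exact Nat.floor_le (div_nonneg ht.1 hh.le)
  · have := (Nat.lt_floor_add_one (t / timeMesh T dt)).le
    rw [div_le_iff₀ hh] at this
    rw [timeNode_eq]
    linarith [timeMesh_le hT hdt]

/-! ### Space grid, interpolation and one step of the scheme -/

namespace Network

variable {d : ℕ} {E : Type*} (G : Network d E)

lemma arcSteps_pos {dx : ℝ} (hdx : 0 < dx) (e : E) : 0 < G.arcSteps dx e :=
  Nat.ceil_pos.2 (div_pos (G.len_pos e) hdx)

lemma arcNode_zero (dx : ℝ) (e : E) : G.arcNode dx e 0 = 0 := by simp [arcNode]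

lemma arcNode_arcSteps {dx : ℝ} (hdx : 0 < dx) (e : E) :
    G.arcNode dx e (G.arcSteps dx e) = G.len e :=
  mul_div_cancel_left₀ _ (Nat.cast_pos.2 (G.arcSteps_pos hdx e)).ne'

lemma arcNode_mem_Icc {dx : ℝ} (hdx : 0 < dx) (e : E) {i : ℕ} (hi : i ≤ G.arcSteps dx e) :
    G.arcNode dx e i ∈ Icc 0 (G.len e) := by
  have hN : (0 : ℝ) < G.arcSteps dx e := Nat.cast_pos.2 (G.arcSteps_pos hdx e)
  have hi' : (i : ℝ) ≤ G.arcSteps dx e := Nat.cast_le.2 hi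
  have hl := G.len_pos e
  refine ⟨by unfold arcNode; positivity, ?_⟩
  rw [arcNode, div_le_iff₀ hN]
  nlinarith

lemma arcNode_succ_sub_le {dx : ℝ} (hdx : 0 < dx) (e : E) (i : ℕ) :
    G.arcNode dx e (i + 1) - G.arcNode dx e i ≤ dx := by
  have hN : (0 : ℝ) < G.arcSteps dx e := Nat.cast_pos.2 (G.arcSteps_pos hdx e)
  have h := Nat.le_ceil (G.len e / dx)
  rw [div_le_iff₀ hdx] at h
  rw [arcNode, arcNode, ← sub_div, div_le_iff₀ hN, mul_comm dx]
  push_cast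
  calc _ = G.len e := by ring
    _ ≤ _ := h

lemma arcNode_lt_succ {dx : ℝ} (hdx : 0 < dx) (e : E) (i : ℕ) :
    G.arcNode dx e i < G.arcNode dx e (i + 1) := by
  have hN : (0 : ℝ) < G.arcSteps dx e := Nat.cast_pos.2 (G.arcSteps_pos hdx e)
  have hl := G.len_pos e
  rw [arcNode, arcNode, div_lt_div_iff_of_pos_right hN]
  push_cast
  nlinarith

lemma cellIndex_lt {dx : ℝ} (hdx : 0 < dx) (e : E) (s : ℝ) :
    G.cellIndex dx e s + 1 ≤ G.arcSteps dx e := by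
  have := G.arcSteps_pos hdx e
  have := min_le_right ⌊s * G.arcSteps dx e / G.len e⌋₊ (G.arcSteps dx e - 1)
  unfold cellIndex
  omega

lemma mem_Icc_cell {dx : ℝ} (hdx : 0 < dx) (e : E) {s : ℝ} (hs : s ∈ Icc 0 (G.len e)) :
    s ∈ Icc (G.arcNode dx e (G.cellIndex dx e s)) (G.arcNode dx e (G.cellIndex dx e s + 1)) := by
  have hNpos := G.arcSteps_pos hdx e
  have hN : (0 : ℝ) < G.arcSteps dx e := Nat.cast_pos.2 hNpos
  have hl := G.len_pos e
  have hq : 0 ≤ s * G.arcSteps dx e / G.len e := by have := hs.1; positivity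
  constructor
  · rw [arcNode, div_le_iff₀ hN, ← le_div_iff₀ hl]
    exact (Nat.cast_le.2 (min_le_left _ _)).trans (Nat.floor_le hq)
  · rcases le_total ⌊s * G.arcSteps dx e / G.len e⌋₊ (G.arcSteps dx e - 1) with h | h
    · rw [cellIndex, min_eq_left h, arcNode, le_div_iff₀ hN, ← div_le_iff₀ hl]
      push_cast
      exact (Nat.lt_floor_add_one _).le
    -- The truncation in `cellIndex` matters at `s = len e`, where the floor alone would point
    -- beyond the last cell.
    · rw [cellIndex, min_eq_right h, Nat.sub_add_cancel hNpos, G.arcNode_arcSteps hdx]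
      exact hs.2

/-- Every point of an arc is near a node. -/
lemma exists_arcNode_near {dx : ℝ} (hdx : 0 < dx) (e : E) {s : ℝ} (hs : s ∈ Icc 0 (G.len e)) :
    ∃ i ≤ G.arcSteps dx e, G.arcNode dx e i ≤ s ∧ s - dx ≤ G.arcNode dx e i := by
  have h := G.mem_Icc_cell hdx e hs
  refine ⟨_, (Nat.le_succ _).trans (G.cellIndex_lt hdx e s), h.1, ?_⟩
  linarith [h.2, G.arcNode_succ_sub_le hdx e (G.cellIndex dx e s)]

/-- Interpolation preserves affine lower bounds, locally. -/
lemma le_interp {dx : ℝ} (hdx : 0 < dx) (e : E) {w : EuclideanSpace ℝ (Fin d) → ℝ}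
    {s A Q : ℝ} (hs : s ∈ Icc 0 (G.len e))
    (hw : ∀ i ≤ G.arcSteps dx e, |G.arcNode dx e i - s| ≤ dx →
      A + Q * G.arcNode dx e i ≤ w (G.curve e (G.arcNode dx e i))) :
    A + Q * s ≤ G.interp dx e w s := by
  have hc := G.mem_Icc_cell hdx e hs
  have hlt := G.cellIndex_lt hdx e s
  have hd := G.arcNode_succ_sub_le hdx e (G.cellIndex dx e s)
  have hpos := G.arcNode_lt_succ hdx e (G.cellIndex dx e s)
  have ha := hw (G.cellIndex dx e s) (by omega) (by
    rw [abs_le]; constructor <;> linarith [hc.1, hc.2])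
  have hb := hw (G.cellIndex dx e s + 1) hlt (by
    rw [abs_le]; constructor <;> linarith [hc.1, hc.2])
  simp only [interp]
  set a := G.arcNode dx e (G.cellIndex dx e s)
  set b := G.arcNode dx e (G.cellIndex dx e s + 1)
  set θ := (s - a) / (b - a) with hθ
  have hba : 0 < b - a := by linarith
  have h0 : 0 ≤ θ := div_nonneg (by linarith [hc.1]) hba.le
  have h1 : θ ≤ 1 := (div_le_one hba).2 (by linarith [hc.2])
  have hs' : s = a + θ * (b - a) := by rw [hθ, div_mul_cancel₀ _ hba.ne']; ring
  calc A + Q * s = (1 - θ) * (A + Q * a) + θ * (A + Q * b) := by rw [hs']; ring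
    _ ≤ (1 - θ) * w (G.curve e a) + θ * w (G.curve e b) := by
      have : 0 ≤ 1 - θ := by linarith
      gcongr
    _ = _ := by ring

/-- Affine subsolutions of `P + H s Q ≤ -ρ` yield lower bounds of the semi-Lagrangian operator. -/
lemma le_arcOp {H : E → ℝ → ℝ → ℝ} {dx h β₀ : ℝ} (hdx : 0 < dx) (hh : 0 < h)
    (e : E) {w : EuclideanSpace ℝ (Fin d) → ℝ} {s s₀ B P Q ρ : ℝ}
    (hL : ∀ α, β₀ < |α| → lagrangian (H e) s α = ⊤)
    (hH : P + H e s Q ≤ -ρ) (hsmall : β₀ * h + dx ≤ ρ / 2) (hss : |s - s₀| ≤ ρ / 2)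
    (hw : ∀ i ≤ G.arcSteps dx e, |G.arcNode dx e i - s₀| ≤ ρ →
      B + Q * (G.arcNode dx e i - s₀) ≤ w (G.curve e (G.arcNode dx e i))) :
    ((B + Q * (s - s₀) + (P + ρ) * h : ℝ) : EReal) ≤ G.arcOp H dx h e w s := by
  refine le_iInf₂ fun α hα => ?_
  -- Only `|α| ≤ β₀` competes, so the foot `s - h * α` is within `β₀ * h` of `s`, and the nodes used
  -- for interpolation there are within `ρ / 2 + β₀ * h + dx ≤ ρ` of `s₀`.
  rcases lt_or_ge β₀ |α| with hbig | hsm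
  · rw [hL α hbig, EReal.coe_mul_top_of_pos hh, EReal.coe_add_top]
    exact le_top
  have hmem : s - h * α ∈ Icc 0 (G.len e) := by
    have h1 := hα.1
    have h2 := hα.2
    rw [div_le_iff₀ hh] at h1
    rw [le_div_iff₀ hh] at h2
    constructor <;> linarith
  have hI : (B - Q * s₀) + Q * (s - h * α) ≤ G.interp dx e w (s - h * α) := by
    refine G.le_interp hdx e hmem fun i hi hd => ?_
    have hα' : |h * α| ≤ β₀ * h := by
      rw [abs_mul, abs_of_pos hh, mul_comm]
      gcongr
    have : |G.arcNode dx e i - s₀| ≤ ρ := by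
      rw [abs_le] at *
      constructor <;> linarith [hd.1, hd.2, hα'.1, hα'.2, hss.1, hss.2]
    linarith [hw i hi this]
  -- The displacement term `-Q * h * α` of the interpolation cancels against Fenchel's `h * Q * α`;
  -- what remains is `-h * H e s Q ≥ (P + ρ) * h`.
  calc ((B + Q * (s - s₀) + (P + ρ) * h : ℝ) : EReal)
      ≤ ((G.interp dx e w (s - h * α) + h * (Q * α - H e s Q) : ℝ) : EReal) := by
        refine EReal.coe_le_coe_iff.2 ?_
        nlinarith
    _ = (G.interp dx e w (s - h * α) : EReal) + (h : EReal) * ((Q * α - H e s Q : ℝ) : EReal) := by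
        rw [EReal.coe_add, EReal.coe_mul]
    _ ≤ _ := by
        gcongr
        exact le_lagrangian _ _ _ _

/-! ### Vertices -/

lemma param_mem {e : E} {x : EuclideanSpace ℝ (Fin d)} (hx : x ∈ G.support e) :
    G.param e x ∈ Icc 0 (G.len e) := Function.invFunOn_mem hx

lemma curve_param {e : E} {x : EuclideanSpace ℝ (Fin d)} (hx : x ∈ G.support e) :
    G.curve e (G.param e x) = x := Function.invFunOn_eq hx

lemma left_mem (e : E) : (0 : ℝ) ∈ Icc 0 (G.len e) := ⟨le_rfl, (G.len_pos e).le⟩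

lemma right_mem (e : E) : G.len e ∈ Icc 0 (G.len e) := ⟨(G.len_pos e).le, le_rfl⟩

/-- A vertex is an endpoint of every arc through it. -/
lemma param_eq_endpoint {e : E} {x : EuclideanSpace ℝ (Fin d)} (hx : x ∈ G.vertices)
    (he : x ∈ G.support e) : G.param e x = 0 ∨ G.param e x = G.len e := by
  obtain ⟨e', he'⟩ := hx
  obtain ⟨s', hs', hs'e, hx'⟩ : ∃ s' ∈ Icc 0 (G.len e'), (s' = 0 ∨ s' = G.len e') ∧
      x = G.curve e' s' := by
    rcases he' with h | h
    · exact ⟨0, G.left_mem e', Or.inl rfl, h⟩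
    · exact ⟨_, G.right_mem e', Or.inr rfl, h⟩
  have hp := G.param_mem he
  have hc := G.curve_param he
  by_cases h1 : e' = e
  · subst h1
    have := G.injOn e' hp hs' (hc.trans hx')
    rwa [this]
  by_cases h2 : e' = G.rev e
  · subst h2
    rw [G.len_rev] at hs' hs'e
    rw [G.curve_rev e s' hs'] at hx'
    have := G.injOn e hp ⟨by linarith [hs'.2], by linarith [hs'.1]⟩ (hc.trans hx')
    rcases hs'e with h | h <;> rw [this, h] <;> simp
  · exact (G.inter_endpoints e e' h1 h2 _ hp _ hs' (hc.trans hx')).1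

lemma posAt_nonempty {x : EuclideanSpace ℝ (Fin d)} (hx : x ∈ G.vertices) :
    (G.posAt x).Nonempty := by
  obtain ⟨e, he⟩ := hx
  have hmem : x ∈ G.support e := by
    rcases he with h | h
    · exact ⟨0, G.left_mem e, h.symm⟩
    · exact ⟨_, G.right_mem e, h.symm⟩
  by_cases hp : e ∈ G.pos
  · exact ⟨e, hp, hmem⟩
  · refine ⟨G.rev e, ?_, ?_⟩
    · rw [G.pos_iff, G.rev_rev]; exact hp
    · obtain ⟨s, hs, rfl⟩ := hmem
      have hs' : G.len e - s ∈ Icc 0 (G.len e) := ⟨by linarith [hs.2], by linarith [hs.1]⟩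
      refine ⟨G.len e - s, by rwa [G.len_rev], ?_⟩
      rw [G.curve_rev e _ hs', sub_sub_cancel]

lemma exists_arcNode_eq_param {dx : ℝ} (hdx : 0 < dx) {e : E} {x : EuclideanSpace ℝ (Fin d)}
    (hx : x ∈ G.vertices) (he : x ∈ G.support e) :
    ∃ i ≤ G.arcSteps dx e, G.arcNode dx e i = G.param e x := by
  rcases G.param_eq_endpoint hx he with h | h
  · exact ⟨0, Nat.zero_le _, by rw [h, arcNode_zero]⟩
  · exact ⟨_, le_rfl, by rw [h, G.arcNode_arcSteps hdx]⟩

/-- A node near a vertex of the arc either is this vertex or is interior. -/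
lemma arcNode_eq_param_or_interior {dx : ℝ} (hdx : 0 < dx) {e : E}
    {x : EuclideanSpace ℝ (Fin d)} (hx : x ∈ G.vertices) (he : x ∈ G.support e) {i : ℕ}
    (hi : i ≤ G.arcSteps dx e) (hnear : |G.arcNode dx e i - G.param e x| < G.len e) :
    G.arcNode dx e i = G.param e x ∨ 0 < i ∧ i < G.arcSteps dx e := by
  have hl := G.len_pos e
  rcases Nat.eq_zero_or_pos i with rfl | h0
  · rw [arcNode_zero] at *
    rcases G.param_eq_endpoint hx he with h | h <;> rw [h] at hnear ⊢
    · exact Or.inl rfl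
    · simp [abs_of_pos hl] at hnear
  rcases hi.eq_or_lt with rfl | h1
  · rw [G.arcNode_arcSteps hdx] at *
    rcases G.param_eq_endpoint hx he with h | h <;> rw [h] at hnear ⊢
    · simp [abs_of_pos hl] at hnear
    · exact Or.inl rfl
  · exact Or.inr ⟨h0, h1⟩

/-! ### Consequences of the convergence of grid functions -/

variable {G} {T : ℝ} {dx dt : ℕ → ℝ}

/-- Every point of an arc of the orientation, at every time, is a limit of grid points. -/
lemma exists_grid_tendsto (hT : 0 < T) (hadm : ∀ m, G.IsAdmissible T (dx m) (dt m))
    (hdx : Tendsto dx atTop (𝓝 0)) (hdt : Tendsto dt atTop (𝓝 0)) {e : E} (he : e ∈ G.pos)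
    {s t : ℝ} (hs : s ∈ Icc 0 (G.len e)) (ht : t ∈ Icc 0 T) :
    ∃ z : ℕ → EuclideanSpace ℝ (Fin d) × ℝ, (∀ m, z m ∈ G.grid T (dx m) (dt m)) ∧
      Tendsto z atTop (𝓝 (G.curve e s, t)) := by
  choose i hi hi1 hi2 using fun m => G.exists_arcNode_near (hadm m).dx_pos e hs
  choose n hn hn1 hn2 using fun m => exists_timeNode_near hT (hadm m).dt_pos ht
  refine ⟨fun m => (G.curve e (G.arcNode (dx m) e (i m)), timeNode T (dt m) (n m)),
    fun m => ⟨e, he, i m, hi m, n m, hn m, rfl⟩, ?_⟩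
  have h1 : Tendsto (fun m => G.arcNode (dx m) e (i m)) atTop (𝓝 s) :=
    tendsto_of_tendsto_of_tendsto_of_le_of_le (by simpa using tendsto_const_nhds.sub hdx)
      tendsto_const_nhds hi2 hi1
  have h2 : Tendsto (fun m => timeNode T (dt m) (n m)) atTop (𝓝 t) :=
    tendsto_of_tendsto_of_tendsto_of_le_of_le (by simpa using tendsto_const_nhds.sub hdt)
      tendsto_const_nhds hn2 hn1
  refine Tendsto.prodMk_nhds ?_ h2
  have hc := (G.contDiffOn e).continuousOn s hs
  exact hc.tendsto.comp (tendsto_nhdsWithin_iff.2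
    ⟨h1, Eventually.of_forall fun m => G.arcNode_mem_Icc (hadm m).dx_pos e (hi m)⟩)

/-- Lower bounds of the limit on compact sets are inherited approximately by the grid functions. -/
lemma eventually_lower_bound (hT : 0 < T) (hadm : ∀ m, G.IsAdmissible T (dx m) (dt m))
    (hdx : Tendsto dx atTop (𝓝 0)) (hdt : Tendsto dt atTop (𝓝 0))
    {v : ℕ → EuclideanSpace ℝ (Fin d) × ℝ → ℝ} {u : EuclideanSpace ℝ (Fin d) × ℝ → ℝ}
    (hu : ConvergesUniformlyOnGrids (fun m => G.grid T (dx m) (dt m))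
      (G.carrier ×ˢ Icc 0 T) v u) {e : E} (he : e ∈ G.pos) {K : Set (ℝ × ℝ)} (hK : IsCompact K)
    (hKs : K ⊆ Icc 0 (G.len e) ×ˢ Icc 0 T) {φ : ℝ × ℝ → ℝ} (hφ : Continuous φ)
    (hle : ∀ q ∈ K, φ q ≤ u (G.curve e q.1, q.2)) {ε : ℝ} (hε : 0 < ε) :
    ∀ᶠ m in atTop, ∀ i ≤ G.arcSteps (dx m) e, ∀ n ≤ timeSteps T (dt m),
      (G.arcNode (dx m) e i, timeNode T (dt m) n) ∈ K →
      φ (G.arcNode (dx m) e i, timeNode T (dt m) n) - ε ≤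
        v m (G.curve e (G.arcNode (dx m) e i), timeNode T (dt m) n) := by
  -- Violating nodes along a subsequence would cluster at some `p ∈ K`, where the limit contradicts
  -- `hle`.
  by_contra hcon
  have hfr : ∃ᶠ m in atTop, ∃ q ∈ K, (G.curve e q.1, q.2) ∈ G.grid T (dx m) (dt m) ∧
      v m (G.curve e q.1, q.2) < φ q - ε := by
    refine (not_eventually.1 hcon).mono fun m hm => ?_
    push Not at hm
    obtain ⟨i, hi, n, hn, hq, hlt⟩ := hm
    exact ⟨_, hq, ⟨e, he, i, hi, n, hn, rfl⟩, hlt⟩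
  obtain ⟨k, hk, hbad⟩ := extraction_of_frequently_atTop hfr
  choose q hqK hqg hqv using hbad
  obtain ⟨p, hpK, j, hj, hlim⟩ := hK.tendsto_subseq hqK
  obtain ⟨z, hz, hzlim⟩ := exists_grid_tendsto hT hadm hdx hdt he (hKs hpK).1 (hKs hpK).2
  have hkj : StrictMono (k ∘ j) := hk.comp hj
  have hqlim : Tendsto (fun l => (G.curve e (q (j l)).1, (q (j l)).2)) atTop
      (𝓝 (G.curve e p.1, p.2)) := by
    refine Tendsto.prodMk_nhds ?_ ((continuous_snd.tendsto p).comp hlim)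
    exact ((G.contDiffOn e).continuousOn p.1 (hKs hpK).1).tendsto.comp (tendsto_nhdsWithin_iff.2
      ⟨(continuous_fst.tendsto p).comp hlim, Eventually.of_forall fun l => (hKs (hqK (j l))).1⟩)
  classical
  -- Convergence is stated for full sequences of grid points, so the gaps between the violating
  -- points are filled by grid points `z m` with the same limit.
  let Z : ℕ → EuclideanSpace ℝ (Fin d) × ℝ := fun m =>
    if h : ∃ l, (k ∘ j) l = m then (G.curve e (q (j h.choose)).1, (q (j h.choose)).2) else z m
  have hZ : ∀ l, Z ((k ∘ j) l) = (G.curve e (q (j l)).1, (q (j l)).2) := by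
    intro l
    have h : ∃ l', (k ∘ j) l' = (k ∘ j) l := ⟨l, rfl⟩
    have hl : h.choose = l := hkj.injective h.choose_spec
    simp only [Z, dif_pos h, hl]
  have hZg : ∀ m, Z m ∈ G.grid T (dx m) (dt m) := by
    intro m
    by_cases h : ∃ l, (k ∘ j) l = m
    · obtain ⟨l, rfl⟩ := h
      rw [hZ]
      exact hqg (j l)
    · simp only [Z, dif_neg h]
      exact hz m
  have hZlim : Tendsto Z atTop (𝓝 (G.curve e p.1, p.2)) := by
    rw [tendsto_def] at hzlim hqlim ⊢
    intro U hU
    obtain ⟨M, hM⟩ := mem_atTop_sets.1 (hzlim U hU)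
    obtain ⟨M', hM'⟩ := mem_atTop_sets.1 (hqlim U hU)
    refine mem_atTop_sets.2 ⟨max M ((k ∘ j) M'), fun m hm => ?_⟩
    by_cases h : ∃ l, (k ∘ j) l = m
    · obtain ⟨l, rfl⟩ := h
      rw [mem_preimage, hZ]
      exact hM' l (hkj.le_iff_le.1 ((le_max_right _ _).trans hm))
    · simp only [mem_preimage, Z, dif_neg h]
      exact hM m ((le_max_left _ _).trans hm)
  have hv := (hu (G.curve e p.1, p.2)
    ⟨mem_iUnion.2 ⟨e, mem_image_of_mem _ (hKs hpK).1⟩, (hKs hpK).2⟩ Z hZg hZlim).comp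
      hkj.tendsto_atTop
  have hφlim : Tendsto (fun l => φ (q (j l)) - ε) atTop (𝓝 (φ p - ε)) :=
    ((hφ.tendsto p).comp hlim).sub_const ε
  have := le_of_tendsto_of_tendsto' hv hφlim fun l => by
    simp only [Function.comp_def] at hZ ⊢
    rw [hZ]
    exact (hqv (j l)).le
  linarith [hle p hpK]

end Network

/-! ### Affine lower bounds from subtangents -/

lemma abs_sub_eq_sign_mul {ℓ s₀ : ℝ} (hs₀ : s₀ = 0 ∨ s₀ = ℓ) :
    ∃ ς : ℝ, |ς| = 1 ∧ ∀ s ∈ Icc 0 ℓ, |s - s₀| = ς * (s - s₀) := by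
  rcases hs₀ with rfl | rfl
  · exact ⟨1, abs_one, fun s hs => by rw [abs_of_nonneg (by linarith [hs.1])]; ring⟩
  · exact ⟨-1, by simp, fun s hs => by rw [abs_of_nonpos (by linarith [hs.2])]; ring⟩

/-- A subtangent at an endpoint of an arc that violates the supersolution inequality yields an
affine one, for times up to `t₀`, with a strict margin. -/
lemma exists_affine_lower_bound {ℓ T s₀ t₀ β₀ μ₀ : ℝ} {H : ℝ → ℝ → ℝ}
    (hH : IsArcHamiltonian ℓ H) (hβ : 0 ≤ β₀) (hμ : 0 < μ₀) (hℓ : 0 ≤ ℓ)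
    (hs₀ : s₀ = 0 ∨ s₀ = ℓ) {f φ : ℝ × ℝ → ℝ}
    (hφ : Network.IsConstrainedSubtangent ℓ T f φ (s₀, t₀))
    (hneg : deriv (fun t => φ (s₀, t)) t₀ +
      modHam H β₀ μ₀ s₀ (deriv (fun s => φ (s, t₀)) s₀) < 0) :
    ∃ P Q, ∀ᶠ ρ in 𝓝[>] (0 : ℝ),
      (∀ s ∈ Icc 0 ℓ, |s - s₀| ≤ ρ → P + modHam H β₀ μ₀ s Q ≤ -ρ) ∧
      ∀ s ∈ Icc 0 ℓ, ∀ t ∈ Icc 0 T, |s - s₀| ≤ ρ → t₀ - ρ ≤ t → t ≤ t₀ →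
        f (s₀, t₀) + P * (t - t₀) + Q * (s - s₀) + ρ * |s - s₀| ≤ f (s, t) := by
  obtain ⟨hd, hmin⟩ := hφ
  have hD := (hd.hasStrictFDerivAt one_ne_zero).hasFDerivAt
  set D := fderiv ℝ φ (s₀, t₀)
  have hp : deriv (fun t => φ (s₀, t)) t₀ = D (0, 1) :=
    (hD.comp_hasDerivAt t₀ ((hasDerivAt_const t₀ s₀).prodMk (hasDerivAt_id t₀))).deriv
  have hq : deriv (fun s => φ (s, t₀)) s₀ = D (1, 0) :=
    (hD.comp_hasDerivAt s₀ ((hasDerivAt_id s₀).prodMk (hasDerivAt_const s₀ t₀))).deriv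
  rw [hp, hq] at hneg
  have hs₀mem : s₀ ∈ Icc 0 ℓ := by rcases hs₀ with rfl | rfl <;> simp [hℓ]
  obtain ⟨ρ₀, hρ₀, hstab⟩ := exists_add_modHam_le_neg hH hβ hμ hs₀mem hneg
  obtain ⟨ς, hς, habs⟩ := abs_sub_eq_sign_mul hs₀
  set η := ρ₀ / 2 with hη
  have hηpos : 0 < η := by positivity
  have hlit := (hasFDerivAt_iff_isLittleO.1 hD).def hηpos
  obtain ⟨r, hr, hloc⟩ := Metric.eventually_nhds_iff.1
    (hlit.and (eventually_nhdsWithin_iff.1 hmin))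
  -- Both changes lower the affine function, as `t ≤ t₀` and `ς * (s - s₀) = |s - s₀|`. They pay for
  -- the remainder `η * (|s - s₀| + |t - t₀|)`; the second `η * |s - s₀|` covers the surplus `ρ * |s
  -- - s₀|`. With `η = ρ₀ / 2` the slopes stay within the stability radius `ρ₀`.
  refine ⟨D (0, 1) + η, D (1, 0) - 2 * η * ς, ?_⟩
  have hsm : ∀ᶠ ρ in 𝓝[>] (0 : ℝ), ρ < min (min r η) ρ₀ :=
    nhdsWithin_le_nhds (eventually_lt_nhds (by positivity))
  filter_upwards [hsm, self_mem_nhdsWithin] with ρ hρ hρpos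
  rw [mem_Ioi] at hρpos
  simp only [lt_min_iff] at hρ
  obtain ⟨⟨hρr, hρη⟩, hρρ₀⟩ := hρ
  constructor
  · intro s hs hss
    refine (hstab s hs _ _ (by linarith) ?_ ?_).trans (by linarith)
    · rw [add_sub_cancel_left, abs_of_pos hηpos]; linarith
    · rw [sub_sub_cancel_left, abs_neg, abs_mul, hς, abs_of_pos (by positivity)]; linarith
  · intro s hs t ht hss ht1 ht2
    have htt : |t - t₀| = t₀ - t := by rw [abs_of_nonpos (by linarith)]; ring
    obtain ⟨h1, h2⟩ := hloc (y := (s, t)) (by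
      simp only [Prod.dist_eq, Real.dist_eq, max_lt_iff]
      exact ⟨by linarith, by linarith⟩)
    have h2 := h2 ⟨hs, ht⟩
    have hDz : D ((s, t) - (s₀, t₀)) = D (1, 0) * (s - s₀) + D (0, 1) * (t - t₀) := by
      have : ((s, t) - (s₀, t₀) : ℝ × ℝ) = (s - s₀) • (1, 0) + (t - t₀) • (0, 1) := by
        simp
      rw [this, map_add, map_smul, map_smul]
      simp only [smul_eq_mul]
      ring
    rw [hDz, Real.norm_eq_abs] at h1
    have hn : ‖((s, t) - (s₀, t₀) : ℝ × ℝ)‖ ≤ |s - s₀| + |t - t₀| := by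
      rw [Prod.norm_def]
      exact max_le (by simp) (by simp)
    have h3 := (abs_le.1 (h1.trans (mul_le_mul_of_nonneg_left hn hηpos.le))).1
    have h4 : ρ * |s - s₀| ≤ η * |s - s₀| := by gcongr
    have h5 := habs s hs
    simp only at h2 h3
    rw [htt] at h3
    have h6 : 2 * η * ς * (s - s₀) = 2 * η * |s - s₀| := by rw [h5]; ring
    linarith

/-- A subtangent in time yields an affine lower bound, for times up to `t₀`, of nearby slope. -/
lemma exists_linear_lower_bound {T t₀ c : ℝ} {f ψ : ℝ → ℝ}
    (hψ : Network.IsSubtangent T f ψ t₀) (hc : deriv ψ t₀ < c) :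
    ∃ P < c, ∀ᶠ ρ in 𝓝[>] (0 : ℝ), ∀ t ∈ Icc 0 T, t₀ - ρ ≤ t → t ≤ t₀ →
      f t₀ + P * (t - t₀) ≤ f t := by
  obtain ⟨hd, hmin⟩ := hψ
  have hD := (hd.differentiableAt one_ne_zero).hasDerivAt
  set η := (c - deriv ψ t₀) / 2 with hη
  have hηpos : 0 < η := by linarith
  have hlit := (hasDerivAt_iff_isLittleO.1 hD).def hηpos
  obtain ⟨r, hr, hloc⟩ := Metric.eventually_nhds_iff.1
    (hlit.and (eventually_nhdsWithin_iff.1 hmin))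
  refine ⟨deriv ψ t₀ + η, by linarith, ?_⟩
  have hsm : ∀ᶠ ρ in 𝓝[>] (0 : ℝ), ρ < r := nhdsWithin_le_nhds (eventually_lt_nhds hr)
  filter_upwards [hsm] with ρ hρ t ht ht1 ht2
  have htt : |t - t₀| = t₀ - t := by rw [abs_of_nonpos (by linarith)]; ring
  obtain ⟨h1, h2⟩ := hloc (y := t) (by rw [Real.dist_eq]; linarith)
  have h2 := h2 ht
  rw [Real.norm_eq_abs, Real.norm_eq_abs, htt, smul_eq_mul] at h1
  have h3 := (abs_le.1 h1).1
  linarith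

/-! ### The barrier -/

namespace Network

variable {d : ℕ} {E : Type*} (G : Network d E)

/-- Propagation of lower bounds by the scheme near a vertex. On the arc `e` the known bound has
slopes `P e` in time and `Q e` in space; at the vertex the slope is some `p ≤ P e`. -/
lemma IsSchemeSolution.le_vertex {H : E → ℝ → ℝ → ℝ} {c g : EuclideanSpace ℝ (Fin d) → ℝ}
    {T dx dt β₀ : ℝ} {v : EuclideanSpace ℝ (Fin d) × ℝ → ℝ}
    (hv : G.IsSchemeSolution H c g T dx dt v) (hT : 0 < T) (hdx : 0 < dx) (hdt : 0 < dt)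
    {x : EuclideanSpace ℝ (Fin d)} (hx : x ∈ G.vertices)
    {P Q : E → ℝ} {p u₀ t₀ ρ κ : ℝ} (hρ : 0 < ρ) (hρt : ρ < t₀)
    (hρl : ∀ e, ρ < G.len e)
    (hL : ∀ e, ∀ s ∈ Icc 0 (G.len e), ∀ α, β₀ < |α| → lagrangian (H e) s α = ⊤)
    (hpc : p + ρ ≤ c x) (hpP : ∀ e ∈ G.posAt x, p ≤ P e)
    (hκρ : 4 * κ ≤ ρ ^ 2)
    (hκP : ∀ e ∈ G.posAt x, (P e - p) * (2 * κ / ρ) + κ ≤ ρ ^ 2 / 4)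
    (hsub : ∀ e ∈ G.posAt x, ∀ s ∈ Icc 0 (G.len e), |s - G.param e x| ≤ ρ →
      P e + H e s (Q e) ≤ -ρ)
    (hsmall : β₀ * timeMesh T dt + dx ≤ ρ / 2) (hmesh : timeMesh T dt ≤ ρ / 2)
    (harc : ∀ e ∈ G.posAt x, ∀ i ≤ G.arcSteps dx e, ∀ n ≤ timeSteps T dt,
      |G.arcNode dx e i - G.param e x| ≤ ρ → t₀ - ρ ≤ timeNode T dt n → timeNode T dt n ≤ t₀ →
      u₀ + P e * (timeNode T dt n - t₀) + Q e * (G.arcNode dx e i - G.param e x) +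
        ρ * |G.arcNode dx e i - G.param e x| - κ ≤
          v (G.curve e (G.arcNode dx e i), timeNode T dt n))
    (hvert : ∀ n ≤ timeSteps T dt, t₀ - ρ ≤ timeNode T dt n → timeNode T dt n ≤ t₀ →
      u₀ + p * (timeNode T dt n - t₀) - κ ≤ v (x, timeNode T dt n))
    {n : ℕ} (hn : n ≤ timeSteps T dt) (hn1 : t₀ - ρ ≤ timeNode T dt n)
    (hn2 : timeNode T dt n ≤ t₀) :
    u₀ + κ + (p + ρ) * (timeNode T dt n - t₀) ≤ v (x, timeNode T dt n) := by
  have hh := timeMesh_pos hT hdt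
  set h := timeMesh T dt with hhdef
  -- The first branch is the known vertex bound; the second, steeper by `ρ`, takes over for `ρ * (t₀
  -- - t) ≤ 2 * κ` and ends at `u₀ + κ`.
  let b : ℝ → ℝ := fun t => max (u₀ - κ + p * (t - t₀)) (u₀ + κ + (p + ρ) * (t - t₀))
  -- Capping `b` by a line of slope `P e + ρ` keeps the arc barrier below the known arc bound
  -- wherever `t₀ - t` or the distance to the vertex is at least `ρ / 2`.
  let B : E → ℝ → ℝ := fun e t => min (b t) (u₀ + ρ ^ 2 / 4 + (P e + ρ) * (t - t₀))
  have hbstep : ∀ t, b (t + h) ≤ b t + (p + ρ) * h := by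
    intro t
    have h1 := le_max_left (u₀ - κ + p * (t - t₀)) (u₀ + κ + (p + ρ) * (t - t₀))
    have h2 := le_max_right (u₀ - κ + p * (t - t₀)) (u₀ + κ + (p + ρ) * (t - t₀))
    have h3 : 0 < ρ * h := by positivity
    refine max_le ?_ ?_ <;> simp only [b] <;> nlinarith
  have hBstep : ∀ e ∈ G.posAt x, ∀ t, B e (t + h) ≤ B e t + (P e + ρ) * h := by
    intro e he t
    have h1 := min_le_left (b (t + h)) (u₀ + ρ ^ 2 / 4 + (P e + ρ) * (t + h - t₀))
    have h2 := min_le_right (b (t + h)) (u₀ + ρ ^ 2 / 4 + (P e + ρ) * (t + h - t₀))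
    have h3 : (p + ρ) * h ≤ (P e + ρ) * h := by
      have := hpP e he
      gcongr
    rw [← sub_le_iff_le_add]
    refine le_min ?_ ?_
    · simp only [B]
      linarith [hbstep t]
    · simp only [B]
      linarith
  suffices key : ∀ n ≤ timeSteps T dt, t₀ - ρ ≤ timeNode T dt n → timeNode T dt n ≤ t₀ →
      (∀ e ∈ G.posAt x, ∀ i ≤ G.arcSteps dx e, |G.arcNode dx e i - G.param e x| ≤ ρ →
        B e (timeNode T dt n) + Q e * (G.arcNode dx e i - G.param e x) ≤
          v (G.curve e (G.arcNode dx e i), timeNode T dt n)) ∧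
      b (timeNode T dt n) ≤ v (x, timeNode T dt n) from
    (le_max_right _ _).trans (key n hn hn1 hn2).2
  clear hn hn1 hn2 n
  intro n
  induction n with
  | zero =>
    -- Vacuous: `ρ < t₀` keeps time `0` out of the window.
    intro _ h1 _
    simp only [timeNode_eq, Nat.cast_zero, zero_mul] at h1
    linarith
  | succ n ih =>
    intro hn h1 h2
    have hsucc := timeNode_succ T dt n
    rw [← hhdef] at hsucc
    set t := timeNode T dt n
    set t' := timeNode T dt (n + 1)
    have hknown : ∀ e ∈ G.posAt x, ∀ i ≤ G.arcSteps dx e, |G.arcNode dx e i - G.param e x| ≤ ρ →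
        ρ ^ 2 / 2 ≤ ρ * (t₀ - t') + ρ * |G.arcNode dx e i - G.param e x| →
        B e t' + Q e * (G.arcNode dx e i - G.param e x) ≤
          v (G.curve e (G.arcNode dx e i), t') := by
      intro e he i hi hd hgain
      refine le_trans ?_ (harc e he i hi (n + 1) hn hd h1 h2)
      have := min_le_right (b t') (u₀ + ρ ^ 2 / 4 + (P e + ρ) * (t' - t₀))
      simp only [B]
      linarith
    have hb2 : ρ * (t₀ - t') ≥ 2 * κ → b t' ≤ v (x, t') := by
      intro hgain
      exact (max_le (by linarith) (by linarith)).trans (hvert (n + 1) hn h1 h2)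
    -- At the first node of the window `t' ≤ t₀ - ρ / 2`, because the mesh is at most `ρ / 2`; the
    -- known bounds start the induction.
    rcases lt_or_ge t (t₀ - ρ) with hlt | hge
    · have hgain : ρ ^ 2 / 2 ≤ ρ * (t₀ - t') := by nlinarith
      exact ⟨fun e he i hi hd => hknown e he i hi hd
        (by linarith [mul_nonneg hρ.le (abs_nonneg (G.arcNode dx e i - G.param e x))]),
        hb2 (by linarith)⟩
    obtain ⟨ihA, ihV⟩ := ih (by omega) hge (by linarith)
    have hop : ∀ e ∈ G.posAt x, ∀ s ∈ Icc 0 (G.len e), |s - G.param e x| ≤ ρ / 2 →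
        ((B e t + Q e * (s - G.param e x) + (P e + ρ) * h : ℝ) : EReal) ≤
          G.arcOp H dx h e (fun y => v (y, t)) s := fun e he s hs hss =>
      G.le_arcOp hdx hh e (hL e s hs) (hsub e he s hs (by linarith)) hsmall hss (ihA e he)
    have hV : b t' ≤ v (x, t') := by
      rcases le_total (2 * κ) (ρ * (t₀ - t')) with hgain | hgain
      · exact hb2 hgain
      rw [← EReal.coe_le_coe_iff, hv.vertex n (by omega) x hx]
      refine le_min (le_iInf₂ fun e he => ?_) ?_
      · refine le_trans ?_ (hop e he _ (G.param_mem he.2) (by simp; positivity))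
        rw [EReal.coe_le_coe_iff, sub_self, mul_zero, add_zero]
        refine le_trans ?_ (hBstep e he t)
        rw [← hsucc]
        -- For `t₀ - t' ≤ 2 * κ / ρ` the cap in `B` is inactive, by the smallness of `κ` in `hκP`,
        -- so `B e t' = b t'` and every arc supports the vertex barrier.
        refine le_min le_rfl ?_
        have hκP' := hκP e he
        have hpP' := hpP e he
        have hle : t₀ - t' ≤ 2 * κ / ρ := by
          rw [le_div_iff₀ hρ]; linarith
        have hm : (P e - p) * (t₀ - t') ≤ (P e - p) * (2 * κ / ρ) :=
          mul_le_mul_of_nonneg_left hle (by linarith)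
        exact max_le (by linarith) (by linarith)
      · rw [EReal.coe_le_coe_iff, hsucc]
        refine (hbstep t).trans (add_le_add ihV ?_)
        gcongr
    refine ⟨fun e he i hi hd => ?_, hV⟩
    rcases le_total (ρ / 2) |G.arcNode dx e i - G.param e x| with hfar | hnear
    · refine hknown e he i hi hd ?_
      nlinarith
    -- The opposite endpoint is excluded by `ρ < len e`; it is a vertex where nothing is known about
    -- the other arcs.
    rcases G.arcNode_eq_param_or_interior hdx hx he.2 hi (by linarith [hρl e]) with heq | ⟨hi0, hi1⟩
    · rw [heq, G.curve_param he.2, sub_self, mul_zero, add_zero]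
      exact (min_le_left _ _).trans hV
    · rw [← EReal.coe_le_coe_iff, hv.interior n (by omega) e he.1 i hi0 hi1]
      refine le_trans ?_ (hop e he _ (G.arcNode_mem_Icc hdx e hi) hnear)
      rw [EReal.coe_le_coe_iff]
      have := hBstep e he t
      rw [← hsucc] at this
      linarith

end Network

/-! ### The slope at the vertex and the contradiction -/

namespace Network

variable {d : ℕ} {E : Type*}

/-- Lower bounds of slope `P₀ < c` at the vertex and `P e` on the arcs can be replaced, at the
vertex, by one whose slope is minimal. -/
lemma exists_minimal_slope [Finite E] {S : Set E} {P : E → ℝ} {P₀ c : ℝ} (hP₀ : P₀ < c)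
    {A : ℝ → ℝ → Prop} (hA₀ : ∀ᶠ ρ in 𝓝[>] (0 : ℝ), A P₀ ρ)
    (hA : ∀ e ∈ S, ∀ᶠ ρ in 𝓝[>] (0 : ℝ), A (P e) ρ) :
    ∃ p < c, (∀ e ∈ S, p ≤ P e) ∧ ∀ᶠ ρ in 𝓝[>] (0 : ℝ), A p ρ := by
  obtain ⟨p, hp, hmin⟩ := (insert P₀ (P '' S)).exists_min_image id
    ((Set.toFinite _).insert _) (insert_nonempty _ _)
  refine ⟨p, (hmin P₀ (mem_insert _ _)).trans_lt hP₀,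
    fun e he => hmin _ (mem_insert_of_mem _ (mem_image_of_mem _ he)), ?_⟩
  rcases hp with rfl | ⟨e, he, rfl⟩
  · exact hA₀
  · exact hA e he

end Network

theorem theorem8p1 {d : ℕ} {E : Type*} [Finite E] (G : Network d E)
    (T : ℝ) (hT : 0 < T)
    -- the original Hamiltonians, flux limiter and initial datum
    (Ht : E → ℝ → ℝ → ℝ) (hHt : G.IsHamiltonian Ht)
    (c : EuclideanSpace ℝ (Fin d) → ℝ) (hc : G.IsFluxLimiter Ht c)
    (g : EuclideanSpace ℝ (Fin d) → ℝ) (K : ℝ≥0) (hg : LipschitzOnWith K g G.carrier)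
    -- the modified Hamiltonians, relative to a compact interval of momenta
    (a b : ℝ) (hab : a ≤ b) (β₀ : ℝ) (μ₀ : E → ℝ)
    (hmod : ∀ e, IsModificationParam (G.len e) (Ht e) (Icc a b) β₀ (μ₀ e))
    (H : E → ℝ → ℝ → ℝ) (hH : ∀ e, H e = modHam (Ht e) β₀ (μ₀ e))
    -- infinitesimal admissible pairs with `Δx / Δt → 0`
    (dx dt : ℕ → ℝ) (hadm : ∀ m, G.IsAdmissible T (dx m) (dt m))
    (hdx : Tendsto dx atTop (𝓝 0)) (hdt : Tendsto dt atTop (𝓝 0))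
    (hratio : Tendsto (fun m => dx m / dt m) atTop (𝓝 0))
    -- the solutions of the scheme, and a uniform limit of a subsequence of them
    (v : ℕ → EuclideanSpace ℝ (Fin d) × ℝ → ℝ)
    (hv : ∀ m, G.IsSchemeSolution H c g T (dx m) (dt m) (v m))
    (σ : ℕ → ℕ) (hσ : StrictMono σ)
    (u : EuclideanSpace ℝ (Fin d) × ℝ → ℝ)
    (hu : ConvergesUniformlyOnGrids (fun m => G.grid T (dx (σ m)) (dt (σ m)))
      (G.carrier ×ˢ Icc 0 T) (fun m => v (σ m)) u) :
    ∀ x ∈ G.vertices, G.SupersolutionAtVertex H c T u x := by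
  rintro x hx t₀ ht₀ ⟨ψ, hψ, hψc⟩
  by_contra hcon
  push Not at hcon
  have hadm' : ∀ m, G.IsAdmissible T (dx (σ m)) (dt (σ m)) := fun m => hadm (σ m)
  have hdx' := hdx.comp hσ.tendsto_atTop
  have hdt' := hdt.comp hσ.tendsto_atTop
  have ht₀' : t₀ ∈ Icc 0 T := Ioc_subset_Icc_self ht₀
  obtain ⟨e₀, he₀⟩ := G.posAt_nonempty hx
  have hβ : 0 ≤ β₀ := by
    obtain ⟨J, β, -, -, -, hβ⟩ := (hmod e₀).lip
    exact β.2.trans hβ.le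
  have hL : ∀ e, ∀ s ∈ Icc 0 (G.len e), ∀ α, β₀ < |α| → lagrangian (H e) s α = ⊤ := by
    intro e s hs α hα
    rw [hH e]
    exact lagrangian_modHam_eq_top (hHt.arc e) hβ (hmod e).pos hs hα
  -- Incidence is placed inside the existential so that `choose` yields slopes `P`, `Q` defined on
  -- all of `E`.
  have haff : ∀ e, ∃ P Q, e ∈ G.posAt x → ∀ᶠ ρ in 𝓝[>] (0 : ℝ),
      (∀ s ∈ Icc 0 (G.len e), |s - G.param e x| ≤ ρ → P + H e s Q ≤ -ρ) ∧
      ∀ s ∈ Icc 0 (G.len e), ∀ t ∈ Icc 0 T, |s - G.param e x| ≤ ρ → t₀ - ρ ≤ t → t ≤ t₀ →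
        u (x, t₀) + P * (t - t₀) + Q * (s - G.param e x) + ρ * |s - G.param e x| ≤
          u (G.curve e s, t) := by
    intro e
    by_cases he : e ∈ G.posAt x
    · obtain ⟨φ, hφ, hneg⟩ := hcon e he
      rw [hH e] at hneg ⊢
      obtain ⟨P, Q, h⟩ := exists_affine_lower_bound (hHt.arc e) hβ (hmod e).pos (G.len_pos e).le
        (G.param_eq_endpoint hx he.2) hφ hneg
      simp only [G.curve_param he.2] at h
      exact ⟨P, Q, fun _ => h⟩
    · exact ⟨0, 0, fun h => absurd h he⟩
  choose P Q hPQ using haff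
  obtain ⟨P₀, hP₀, hlin⟩ := exists_linear_lower_bound hψ hψc
  obtain ⟨p, hpc, hpP, hp⟩ := Network.exists_minimal_slope (S := G.posAt x) (P := P) hP₀
    (A := fun p ρ => ∀ t ∈ Icc 0 T, t₀ - ρ ≤ t → t ≤ t₀ → u (x, t₀) + p * (t - t₀) ≤ u (x, t)) hlin
    -- Each arc bound, restricted to the vertex, loses its space terms and becomes a bound in time
    -- of slope `P e`.
    (fun e he => (hPQ e he).mono fun ρ h t ht ht1 ht2 => by
      have hρ : 0 ≤ ρ := by linarith
      simpa [G.curve_param he.2] using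
        h.2 _ (G.param_mem he.2) t ht (by simpa using hρ) ht1 ht2)
  have hsmall : ∀ δ > (0 : ℝ), ∀ᶠ ρ in 𝓝[>] (0 : ℝ), ρ < δ := fun δ hδ =>
    nhdsWithin_le_nhds (eventually_lt_nhds hδ)
  obtain ⟨ρ, hρP, hρp, hρt, hρc, hρl, hρ⟩ := ((eventually_all.2 fun e =>
    eventually_imp_distrib_left.2 (hPQ e)).and (hp.and ((hsmall t₀ ht₀.1).and
      ((hsmall (c x - p) (by linarith)).and ((eventually_all.2 fun e =>
        hsmall (G.len e) (G.len_pos e)).and self_mem_nhdsWithin))))).exists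
  -- `κ` is chosen after `ρ`, small compared with `ρ ^ 2`, and before the grid index.
  have hκP : ∀ e, ∀ᶠ κ in 𝓝[>] (0 : ℝ), (P e - p) * (2 * κ / ρ) + κ < ρ ^ 2 / 4 := by
    intro e
    refine nhdsWithin_le_nhds (Tendsto.eventually_lt_const (v := (P e - p) * (2 * 0 / ρ) + 0)
      (by simp; positivity) ?_)
    exact Continuous.tendsto (by fun_prop) _
  obtain ⟨κ, hκP, hκρ, hκ⟩ := ((eventually_all.2 hκP).and
    ((hsmall (ρ ^ 2 / 4) (by positivity)).and self_mem_nhdsWithin)).exists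
  have harc : ∀ e, ∀ᶠ m in atTop, e ∈ G.posAt x → ∀ i ≤ G.arcSteps (dx (σ m)) e,
      ∀ n ≤ timeSteps T (dt (σ m)), |G.arcNode (dx (σ m)) e i - G.param e x| ≤ ρ →
      t₀ - ρ ≤ timeNode T (dt (σ m)) n → timeNode T (dt (σ m)) n ≤ t₀ →
      u (x, t₀) + P e * (timeNode T (dt (σ m)) n - t₀) +
        Q e * (G.arcNode (dx (σ m)) e i - G.param e x) +
        ρ * |G.arcNode (dx (σ m)) e i - G.param e x| - κ ≤
          v (σ m) (G.curve e (G.arcNode (dx (σ m)) e i), timeNode T (dt (σ m)) n) := by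
    intro e
    refine eventually_imp_distrib_left.2 fun he => ?_
    have := Network.eventually_lower_bound hT hadm' hdx' hdt' hu he.1
      (K := (Icc 0 (G.len e) ∩ Icc (G.param e x - ρ) (G.param e x + ρ)) ×ˢ Icc (t₀ - ρ) t₀)
      ((isCompact_Icc.inter isCompact_Icc).prod isCompact_Icc)
      (prod_mono inter_subset_left (Icc_subset_Icc (by linarith) ht₀.2))
      (φ := fun q => u (x, t₀) + P e * (q.2 - t₀) + Q e * (q.1 - G.param e x) +
        ρ * |q.1 - G.param e x|) (by fun_prop)
      (fun q hq => (hρP e he).2 q.1 hq.1.1 q.2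
        ⟨by linarith [hq.2.1], by linarith [hq.2.2, ht₀.2]⟩
        (abs_le.2 ⟨by linarith [hq.1.2.1], by linarith [hq.1.2.2]⟩) hq.2.1 hq.2.2) hκ
    refine this.mono fun m hm i hi n hn hd h1 h2 => hm i hi n hn ?_
    rw [abs_le] at hd
    exact ⟨⟨G.arcNode_mem_Icc (hadm' m).dx_pos e hi, by constructor <;> linarith [hd.1, hd.2]⟩,
      h1, h2⟩
  have hvert : ∀ᶠ m in atTop, ∀ n ≤ timeSteps T (dt (σ m)),
      t₀ - ρ ≤ timeNode T (dt (σ m)) n → timeNode T (dt (σ m)) n ≤ t₀ →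
      u (x, t₀) + p * (timeNode T (dt (σ m)) n - t₀) - κ ≤
        v (σ m) (x, timeNode T (dt (σ m)) n) := by
    have := Network.eventually_lower_bound hT hadm' hdx' hdt' hu he₀.1
      (K := {G.param e₀ x} ×ˢ Icc (t₀ - ρ) t₀) (isCompact_singleton.prod isCompact_Icc)
      (prod_mono (singleton_subset_iff.2 (G.param_mem he₀.2))
        (Icc_subset_Icc (by linarith) ht₀.2))
      (φ := fun q => u (x, t₀) + p * (q.2 - t₀)) (by fun_prop)
      (by
        rintro ⟨s, t⟩ ⟨hs, ht⟩
        obtain rfl : s = _ := hs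
        simp only [G.curve_param he₀.2]
        exact hρp t ⟨by linarith [ht.1], by linarith [ht.2, ht₀.2]⟩ ht.1 ht.2) hκ
    refine this.mono fun m hm n hn h1 h2 => ?_
    obtain ⟨i, hi, hie⟩ := G.exists_arcNode_eq_param (hadm' m).dx_pos hx he₀.2
    have := hm i hi n hn ⟨hie, h1, h2⟩
    rwa [hie, G.curve_param he₀.2] at this
  choose n hn hn1 hn2 using fun m => exists_timeNode_near hT (hadm' m).dt_pos ht₀'
  have hnlim : Tendsto (fun m => timeNode T (dt (σ m)) (n m)) atTop (𝓝 t₀) :=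
    tendsto_of_tendsto_of_tendsto_of_le_of_le (by simpa using tendsto_const_nhds.sub hdt')
      tendsto_const_nhds hn2 hn1
  have hvlim : Tendsto (fun m => v (σ m) (x, timeNode T (dt (σ m)) (n m))) atTop
      (𝓝 (u (x, t₀))) := by
    refine hu (x, t₀) ⟨mem_iUnion.2 ⟨e₀, he₀.2⟩, ht₀'⟩
      (fun m => (x, timeNode T (dt (σ m)) (n m))) (fun m => ?_)
      (tendsto_const_nhds.prodMk_nhds hnlim)
    obtain ⟨i, hi, hie⟩ := G.exists_arcNode_eq_param (hadm' m).dx_pos hx he₀.2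
    exact ⟨e₀, he₀.1, i, hi, n m, hn m, by rw [hie, G.curve_param he₀.2]⟩
  have hblim : Tendsto (fun m => u (x, t₀) + κ + (p + ρ) * (timeNode T (dt (σ m)) (n m) - t₀))
      atTop (𝓝 (u (x, t₀) + κ)) := by
    simpa using tendsto_const_nhds.add ((hnlim.sub_const t₀).const_mul (p + ρ))
  -- As `timeMesh ≤ dt`, this one bound gives both mesh conditions of `le_vertex`.
  have hstep : ∀ᶠ m in atTop, (β₀ + 1) * dt (σ m) + dx (σ m) < ρ / 2 := by
    refine Tendsto.eventually_lt_const (v := (β₀ + 1) * 0 + 0) (by simpa using hρ) ?_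
    exact (hdt'.const_mul _).add hdx'
  have hfinal : u (x, t₀) + κ ≤ u (x, t₀) := by
    refine le_of_tendsto_of_tendsto hblim hvlim ?_
    filter_upwards [eventually_all.2 harc, hvert, hstep,
      hnlim.eventually_const_lt (show t₀ - ρ < t₀ by linarith)] with m hm1 hm2 hm3 hm4
    have hdtpos := (hadm' m).dt_pos
    have hdxpos := (hadm' m).dx_pos
    have hmesh := timeMesh_le hT hdtpos
    have hmesh' : β₀ * timeMesh T (dt (σ m)) ≤ β₀ * dt (σ m) := by gcongr
    have hβdt : 0 ≤ β₀ * dt (σ m) := by positivity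
    exact (hv (σ m)).le_vertex G hT hdxpos hdtpos hx hρ hρt hρl hL (by linarith) hpP
      (by linarith) (fun e _ => (hκP e).le) (fun e he => (hρP e he).1) (by linarith)
      (by linarith) (fun e he => hm1 e he) hm2 (hn m) hm4.le (hn1 m)
  linarith
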